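/- Let $\mathbb{k}$ be a field of positive characteristic $p$, let $m\ge 0$ and let $d_1,\dots,d_m$ be positive integers. Let $\mathbb{K}=\mathbb{k}\big(a_{i,\mathbf r} : 1\le i\le m,\ \mathbf r\in\mathbb{N}^m,\ r_1+\cdots+r_m=d_i\big)$ be the field of rational functions over $\mathbb{k}$ in the independent variables $a_{i,\mathbf r}$. In $\mathbb{K}[x_1,\dots,x_m]$, with the standard grading, consider the generic forms $$g_i=\sum_{\mathbf r\in\mathbb{N}^m,\ r_1+\cdots+r_m=d_i} a_{i,\mathbf r}\,x_1^{r_1}\cdots x_m^{r_m}\qquad (i=1,\dots,m).$$ Let $\mathcal A=\mathbb{K}[x_1,\dots,x_m]/(g_1,\dots,g_m)$ be the generic $(d_1,\dots,d_m)$-complete intersection reduction of $\mathbb{k}[x_1,\dots,x_m]$, graded by degree, let $\pi:\mathbb{K}[x_1,\dots,x_m]\to\mathcal A$ be the natural projection, and put $s=-m+d_1+\cdots+d_m$ and $\ell=x_1+\cdots+x_m$. Let $i,k\ge 0$ be integers with $pi+k\le s$ and let $\alpha\in\mathbb{K}[x_1,\dots,x_m]$ be homogeneous of degree $i$. If $\pi(\alpha)\ne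 0$, then $\pi(\alpha^p\ell^k)\ne 0$. In particular $\mathcal A$ is $p$-anisotropic in degrees at most $s/p$: if $0\le i\le s/p$ and $\alpha\in\mathcal A_i$ is nonzero, then $\alpha^p\ne 0$. -/

import Mathlib

noncomputable section

namespace GenericCI

/-- The finite set `ℕ^m_n` of exponent vectors `r = (r_1, …, r_m)` with `r_1 + ⋯ + r_m = n`. -/
def expVectors (m n : ℕ) : Finset (Fin m →₀ ℕ) :=
  Finset.finsuppAntidiag Finset.univ n

theorem mem_expVectors {m n : ℕ} {r : Fin m →₀ ℕ} :
    r ∈ expVectors m n ↔ ∑ t, r t = n := by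
  simp [expVectors, Finset.mem_finsuppAntidiag]

/-- The index set of all pairs `(i, r)` with `1 ≤ i ≤ m` and `r ∈ ℕ^m_{d_i}`. -/
abbrev IndexSet {m : ℕ} (d : Fin m → ℕ) : Type :=
  Σ i : Fin m, {r : Fin m →₀ ℕ // r ∈ expVectors m (d i)}

/-- The purely transcendental extension `𝕂 = 𝕜(a_{i,r})` of `𝕜`, the field of rational functions
in the auxiliary indeterminates `a_{i,r}`. -/
abbrev AuxField (𝕜 : Type*) [Field 𝕜] {m : ℕ} (d : Fin m → ℕ) : Type _ :=
  FractionRing (MvPolynomial (IndexSet d) 𝕜)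

/-- The auxiliary indeterminate `a_{i,r}`, as an element of `𝕂`. -/
def auxVar (𝕜 : Type*) [Field 𝕜] {m : ℕ} (d : Fin m → ℕ) (j : IndexSet d) : AuxField 𝕜 d :=
  algebraMap (MvPolynomial (IndexSet d) 𝕜) (AuxField 𝕜 d) (MvPolynomial.X j)

/-- The generic form `g_i = ∑_{r ∈ ℕ^m_{d_i}} a_{i,r} x^r` in `𝕂[x_1, …, x_m]`. -/
def genericForm (𝕜 : Type*) [Field 𝕜] {m : ℕ} (d : Fin m → ℕ) (i : Fin m) :
    MvPolynomial (Fin m) (AuxField 𝕜 d) :=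
  ∑ r : {r : Fin m →₀ ℕ // r ∈ expVectors m (d i)},
    MvPolynomial.monomial r.1 (auxVar 𝕜 d ⟨i, r⟩)

/-- The ideal `(g_1, …, g_m)` of `𝕂[x_1, …, x_m]`. -/
def genericIdeal (𝕜 : Type*) [Field 𝕜] {m : ℕ} (d : Fin m → ℕ) :
    Ideal (MvPolynomial (Fin m) (AuxField 𝕜 d)) :=
  Ideal.span (Set.range (genericForm 𝕜 d))

/-- The generic `(d_1, …, d_m)`-complete intersection reduction
`𝒜 = 𝕂[x_1, …, x_m] / (g_1, …, g_m)` of `𝕜[x_1, …, x_m]`. -/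
abbrev Reduction (𝕜 : Type*) [Field 𝕜] {m : ℕ} (d : Fin m → ℕ) : Type _ :=
  MvPolynomial (Fin m) (AuxField 𝕜 d) ⧸ genericIdeal 𝕜 d

/-- The natural projection `π : 𝕂[x_1, …, x_m] → 𝒜`. -/
def proj (𝕜 : Type*) [Field 𝕜] {m : ℕ} (d : Fin m → ℕ) :
    MvPolynomial (Fin m) (AuxField 𝕜 d) →ₐ[AuxField 𝕜 d] Reduction 𝕜 d :=
  Ideal.Quotient.mkₐ (AuxField 𝕜 d) (genericIdeal 𝕜 d)

/-- The graded piece `𝒜_i`: the image under `π` of the forms of degree `i`. -/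
def gradedPiece (𝕜 : Type*) [Field 𝕜] {m : ℕ} (d : Fin m → ℕ) (i : ℕ) :
    Submodule (AuxField 𝕜 d) (Reduction 𝕜 d) :=
  (MvPolynomial.homogeneousSubmodule (Fin m) (AuxField 𝕜 d) i).map (proj 𝕜 d).toLinearMap

/-- The linear form `ℓ = x_1 + ⋯ + x_m` in `𝕂[x_1, …, x_m]`. -/
def linForm (𝕜 : Type*) [Field 𝕜] {m : ℕ} (d : Fin m → ℕ) :
    MvPolynomial (Fin m) (AuxField 𝕜 d) :=
  ∑ t, MvPolynomial.X t

/-- The integer `s = -m + d_1 + ⋯ + d_m`, which is the top degree of `𝒜`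
when all `d_i` are positive. -/
def topDegree {m : ℕ} (d : Fin m → ℕ) : ℤ :=
  -(m : ℤ) + ∑ i, (d i : ℤ)

end GenericCI

end

/-!
Let `R = 𝕜[a_{i,r}]`, let `J = (g_1, …, g_m)` in `R[x]`, and suppose `α ^ p ℓ ^ k ∈ J` with `k < p`.
Then `α ^ p ℓ ^ k ∏ g_j ^ (p - 1)` lies in `(g_1 ^ p, …, g_m ^ p)`. Differentiation with respect to
`a_{i,r}` kills `α ^ p` and all `g_j ^ p`, preserves the ideal they generate, and turns `g_i ^ e`
into `e g_i ^ (e - 1) x ^ r`. As all exponents are less than `p`, the factors `g_j` can be traded one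
by one for monomials, so `α ^ p ℓ ^ k x ^ T` is in `(g_1 ^ p, …, g_m ^ p)` for every `T` of degree at
least `(p - 1) (d_1 + ⋯ + d_m)` (`GenericCI.mul_monomial_mem_of_mul_prod_mem`).

A `p⁻¹`-linear operator `Φ` of Cartier type (`GenericCI.cartier`) maps `(g_1 ^ p, …, g_m ^ p)` to `J`
and satisfies `Φ (α ^ p F) = α Φ F`. For `x ^ z` of degree `s - i` there is a `T` with
`Φ (ℓ ^ k x ^ T) = x ^ z`, because `k < p`, and the hypothesis `p i + k ≤ s` is what makes the degree
of `T` large enough. Hence `α x ^ z ∈ J` for all `z` of degree `s - i`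
(`GenericCI.mul_monomial_mem_of_pow_mul_mem`).

It remains to see that the socle of `𝒜` lives in degree `s` (`GenericCI.exists_C_mul_mem_span`). At
a suitable point of the parameter space, with maximal ideal `𝔟`, the `g_i` specialize to
`x_i ^ d_i`, for which this is clear. Flatness near that point takes the form
`J ∩ 𝔟 ^ n R[x] = 𝔟 ^ n J` (`GenericCI.mem_pow_mul_span`) and shows that `α ∈ J + 𝔟 ^ n R[x]` for
all `n`; by Krull's intersection theorem `α` is in `J` up to a nonzero factor from `R`.

For `k ≥ p` write `k = p q + r` with `r < p`, so that `α ^ p ℓ ^ k = (α ℓ ^ q) ^ p ℓ ^ r`, and use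
induction on `k` (`GenericCI.mem_genericIdeal_of_pow_mul_mem`).
-/

namespace GenericCI

open MvPolynomial

/-! ### The socle of a complete intersection that specializes to a monomial one -/

section Socle

variable {R : Type*} [CommRing R] {m : ℕ} {d : Fin m → ℕ} {𝔟 : Ideal R}
  {g : Fin m → MvPolynomial (Fin m) R}

theorem mem_map_C_pow_iff {n : ℕ} {f : MvPolynomial (Fin m) R} :
    f ∈ (𝔟.map (C (σ := Fin m))) ^ n ↔ ∀ u, coeff u f ∈ 𝔟 ^ n := by
  rw [← Ideal.map_pow, mem_map_C_iff]

theorem monomial_mem_map_C_pow {n : ℕ} {c : R} (hc : c ∈ 𝔟 ^ n) (u : Fin m →₀ ℕ) :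
    monomial u c ∈ (𝔟.map (C (σ := Fin m))) ^ n := by
  classical
  rw [mem_map_C_pow_iff]
  intro v
  rw [coeff_monomial]
  split_ifs
  · exact hc
  · exact zero_mem _

/-- `F` agrees, modulo `𝔟 ^ (n + 1) J`, with a combination of the `g i` whose coefficients lie in
`𝔟 ^ n` and are reduced: the `i`-th one involves no monomial divisible by an `x_j ^ d_j`
with `j < i`. -/
def HasReducedForm (d : Fin m → ℕ) (𝔟 : Ideal R) (g : Fin m → MvPolynomial (Fin m) R) (n : ℕ)
    (F : MvPolynomial (Fin m) R) : Prop :=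
  ∃ h : Fin m → MvPolynomial (Fin m) R, (∀ i, h i ∈ (𝔟.map C) ^ n) ∧
    (∀ i u, coeff u (h i) ≠ 0 → ∀ j < i, u j < d j) ∧
    F - ∑ i, h i * g i ∈ (𝔟.map C) ^ (n + 1) * Ideal.span (Set.range g)

theorem HasReducedForm.zero (n : ℕ) : HasReducedForm d 𝔟 g n 0 :=
  ⟨0, fun _ => zero_mem _, fun i u h => by simp at h, by simp⟩

theorem HasReducedForm.add {n : ℕ} {F G : MvPolynomial (Fin m) R}
    (hF : HasReducedForm d 𝔟 g n F) (hG : HasReducedForm d 𝔟 g n G) :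
    HasReducedForm d 𝔟 g n (F + G) := by
  obtain ⟨h, h1, h2, h3⟩ := hF
  obtain ⟨k, k1, k2, k3⟩ := hG
  refine ⟨h + k, fun i => add_mem (h1 i) (k1 i), fun i u hu => ?_, ?_⟩
  · by_cases hh : coeff u (h i) = 0
    · exact k2 i u (by simpa [hh] using hu)
    · exact h2 i u hh
  · have := add_mem h3 k3
    simp only [Pi.add_apply, add_mul, Finset.sum_add_distrib]
    convert this using 1
    ring

theorem HasReducedForm.sum {n : ℕ} {ι : Type*} (s : Finset ι) (F : ι → MvPolynomial (Fin m) R)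
    (hF : ∀ i ∈ s, HasReducedForm d 𝔟 g n (F i)) :
    HasReducedForm d 𝔟 g n (∑ i ∈ s, F i) := by
  classical
  induction s using Finset.induction_on with
  | empty => simpa using HasReducedForm.zero n
  | insert a s ha ih =>
    rw [Finset.sum_insert ha]
    exact (hF a (by simp)).add (ih fun i hi => hF i (by simp [hi]))

theorem HasReducedForm.of_mem {n : ℕ} {F : MvPolynomial (Fin m) R}
    (hF : F ∈ (𝔟.map C) ^ (n + 1) * Ideal.span (Set.range g)) : HasReducedForm d 𝔟 g n F :=
  ⟨0, fun _ => zero_mem _, fun i u h => by simp at h, by simpa using hF⟩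

/-- A multiple of `x_j ^ d_j` with `j < i` in the coefficient of `g i` is traded, up to higher
order in `𝔟`, for a coefficient of `g j`; induction on `i` ends this. -/
theorem hasReducedForm_monomial_mul (hg : ∀ i, g i - X i ^ d i ∈ 𝔟.map C) {n : ℕ} (i : Fin m) :
    ∀ (u : Fin m →₀ ℕ) {c : R}, c ∈ 𝔟 ^ n → HasReducedForm d 𝔟 g n (monomial u c * g i) := by
  classical
  induction i using WellFoundedLT.induction with
  | ind i ih =>
  intro u c hc
  by_cases hred : ∀ j < i, u j < d j
  · refine ⟨Pi.single i (monomial u c), fun k => ?_, fun k v hv => ?_, ?_⟩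
    · by_cases hk : k = i
      · subst hk
        simpa using monomial_mem_map_C_pow hc u
      · simp [hk]
    · by_cases hk : k = i
      · subst hk
        have : u = v := by
          by_contra hne
          simp [coeff_monomial, hne] at hv
        exact this ▸ hred
      · simp [hk] at hv
    · rw [Finset.sum_eq_single i (fun k _ hk => by simp [hk]) (by simp)]
      simp
  · push Not at hred
    obtain ⟨j, hji, hj⟩ := hred
    obtain ⟨u', rfl⟩ : ∃ u', u = u' + Finsupp.single j (d j) :=
      ⟨u - Finsupp.single j (d j), (tsub_add_cancel_of_le (by simpa using hj)).symm⟩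
    have hswap : monomial (u' + Finsupp.single j (d j)) c * g i =
        (monomial u' c * g i) * g j - (monomial u' c * (g j - X j ^ d j)) * g i := by
      have : monomial (u' + Finsupp.single j (d j)) c = monomial u' c * X j ^ d j := by
        rw [X_pow_eq_monomial, monomial_mul, mul_one]
      rw [this]
      ring
    have hsum : (monomial u' c * g i) * g j =
        ∑ w ∈ (g i).support, monomial (u' + w) (c * coeff w (g i)) * g j := by
      conv_lhs => rw [(g i).as_sum]
      simp only [Finset.mul_sum, Finset.sum_mul, monomial_mul]
    rw [hswap, sub_eq_add_neg, hsum]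
    refine HasReducedForm.add (HasReducedForm.sum _ _ fun w _ =>
      ih j hji _ (Ideal.mul_mem_right _ _ hc)) (HasReducedForm.of_mem (neg_mem ?_))
    refine Ideal.mul_mem_mul ?_ (Ideal.subset_span ⟨i, rfl⟩)
    rw [pow_succ]
    exact Ideal.mul_mem_mul (monomial_mem_map_C_pow hc _) (hg j)

theorem hasReducedForm_of_mem_mul (hg : ∀ i, g i - X i ^ d i ∈ 𝔟.map C) {n : ℕ}
    {F : MvPolynomial (Fin m) R} (hF : F ∈ (𝔟.map C) ^ n * Ideal.span (Set.range g)) :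
    HasReducedForm d 𝔟 g n F := by
  classical
  rw [← smul_eq_mul] at hF
  obtain ⟨a, ha, rfl⟩ := (Submodule.mem_ideal_smul_span_iff_exists_sum _ _ _).1 hF
  refine HasReducedForm.sum _ _ fun i _ => ?_
  change HasReducedForm d 𝔟 g n (a i * g i)
  rw [(a i).as_sum, Finset.sum_mul]
  exact HasReducedForm.sum _ _ fun u _ =>
    hasReducedForm_monomial_mul hg i u (mem_map_C_pow_iff.1 (ha i) u)

/-- In the leading part of a reduced combination of the `g i` nothing cancels: with `g i` replaced
by `x_i ^ d_i`, the `i`-th summand is the part of the sum divisible by `x_i ^ d_i` and by no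
`x_j ^ d_j` with `j < i`. So if the sum has coefficients in `𝔟 ^ (n + 1)`, its summands do. -/
theorem mem_pow_succ_mul_span (hg : ∀ i, g i - X i ^ d i ∈ 𝔟.map C) {n : ℕ}
    {F : MvPolynomial (Fin m) R} (hF : F ∈ (𝔟.map C) ^ n * Ideal.span (Set.range g))
    (hF' : F ∈ (𝔟.map (C (σ := Fin m))) ^ (n + 1)) :
    F ∈ (𝔟.map C) ^ (n + 1) * Ideal.span (Set.range g) := by
  classical
  obtain ⟨h, h1, h2, h3⟩ := hasReducedForm_of_mem_mul hg hF
  have hlead : ∑ i, h i * X i ^ d i ∈ (𝔟.map (C (σ := Fin m))) ^ (n + 1) := by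
    have e : ∑ i, h i * X i ^ d i =
        F - (F - ∑ i, h i * g i) - ∑ i, h i * (g i - X i ^ d i) := by
      simp only [mul_sub, Finset.sum_sub_distrib]
      ring
    rw [e]
    refine sub_mem (sub_mem hF' (Ideal.mul_le_left h3)) (sum_mem fun i _ => ?_)
    rw [pow_succ]
    exact Ideal.mul_mem_mul (h1 i) (hg i)
  have hh : ∀ i, h i ∈ (𝔟.map (C (σ := Fin m))) ^ (n + 1) := by
    intro i
    rw [mem_map_C_pow_iff] at hlead ⊢
    intro u
    by_cases hu : coeff u (h i) = 0
    · simp [hu]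
    have hlt := h2 i u hu
    have key := hlead (u + Finsupp.single i (d i))
    simp only [coeff_sum, X_pow_eq_monomial, coeff_mul_monomial', mul_one] at key
    rw [Finset.sum_eq_single i] at key
    · simpa using key
    · intro k _ hk
      rw [ite_eq_right_iff]
      intro hle
      by_contra hne
      rcases lt_or_gt_of_ne hk with hlt' | hgt
      · have h4 := hlt k hlt'
        have h5 : d k ≤ u k := by simpa [Finsupp.single_le_iff, hk] using hle
        omega
      · have := h2 k _ hne i hgt
        simp [hk] at this
    · simp
  have e : F = (F - ∑ i, h i * g i) + ∑ i, h i * g i := by ring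
  rw [e]
  exact add_mem h3 (sum_mem fun i _ => Ideal.mul_mem_mul (hh i) (Ideal.subset_span ⟨i, rfl⟩))

/-- Elements of `J = (g_1, …, g_m)` with coefficients in `𝔟 ^ n` lie in `𝔟 ^ n J`: the
`𝔟`-adic form of the flatness of the quotient by `J`. -/
theorem mem_pow_mul_span (hg : ∀ i, g i - X i ^ d i ∈ 𝔟.map C) (n : ℕ)
    {F : MvPolynomial (Fin m) R} (hF : F ∈ Ideal.span (Set.range g))
    (hF' : F ∈ (𝔟.map (C (σ := Fin m))) ^ n) :
    F ∈ (𝔟.map C) ^ n * Ideal.span (Set.range g) := by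
  induction n with
  | zero => simpa using hF
  | succ n ih =>
    exact mem_pow_succ_mul_span hg (ih (Ideal.pow_le_pow_right n.le_succ hF')) hF'

/-- Modulo `𝔟` the ideal `J` becomes `(x_1 ^ d_1, …, x_m ^ d_m)`, which contains no `x ^ v` with
`v < d`. -/
theorem coeff_mem_of_mem_pow_mul_span (hg : ∀ i, g i - X i ^ d i ∈ 𝔟.map C) {n : ℕ}
    {F : MvPolynomial (Fin m) R} (hF : F ∈ (𝔟.map C) ^ n * Ideal.span (Set.range g))
    {v : Fin m →₀ ℕ} (hv : ∀ i, v i < d i) : coeff v F ∈ 𝔟 ^ (n + 1) := by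
  classical
  obtain ⟨h, h1, -, h3⟩ := hasReducedForm_of_mem_mul hg hF
  have e : F = (F - ∑ i, h i * g i) + ∑ i, h i * (g i - X i ^ d i) + ∑ i, h i * X i ^ d i := by
    simp only [mul_sub, Finset.sum_sub_distrib]
    ring
  have h4 : coeff v (∑ i, h i * X i ^ d i) = 0 := by
    simp only [coeff_sum, X_pow_eq_monomial, coeff_mul_monomial', mul_one]
    refine Finset.sum_eq_zero fun i _ => if_neg fun hle => ?_
    have := hv i
    rw [Finsupp.single_le_iff] at hle
    omega
  rw [e, coeff_add, h4, add_zero]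
  refine mem_map_C_pow_iff.1 (add_mem (Ideal.mul_le_left h3) (sum_mem fun i _ => ?_)) v
  rw [pow_succ]
  exact Ideal.mul_mem_mul (h1 i) (hg i)

/-- If `β` of degree `j` has coefficients in `𝔟 ^ n` and is killed modulo `J` by the monomials of
complementary degree, then modulo `J` its coefficients can be moved into `𝔟 ^ (n + 1)`: those at
`x ^ u` with `u < d` are there already, as `x ^ u` times some monomial of complementary degree
is the socle monomial `∏ x_i ^ (d_i - 1)`, and the other monomials `x ^ u` are reduced by
some `g i`. -/
theorem mem_span_sup_pow_succ (hg : ∀ i, g i - X i ^ d i ∈ 𝔟.map C) {n j k : ℕ}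
    (hjk : j + k + m = ∑ i, d i) {β : MvPolynomial (Fin m) R} (hβ : β.IsHomogeneous j)
    (hβn : β ∈ (𝔟.map (C (σ := Fin m))) ^ n)
    (hkill : ∀ z : Fin m →₀ ℕ, z.degree = k → β * monomial z 1 ∈ Ideal.span (Set.range g)) :
    β ∈ Ideal.span (Set.range g) ⊔ (𝔟.map C) ^ (n + 1) := by
  classical
  rw [β.as_sum]
  refine sum_mem fun u hu => ?_
  have hdeg : u.degree = j := by
    by_contra hne
    exact (mem_support_iff.1 hu) (hβ.coeff_eq_zero hne)
  by_cases hlt : ∀ i, u i < d i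
  · refine Ideal.mem_sup_right (monomial_mem_map_C_pow ?_ u)
    obtain ⟨z, hz⟩ : ∃ z : Fin m →₀ ℕ, ∀ i, z i = d i - 1 - u i :=
      ⟨Finsupp.equivFunOnFinite.symm fun i => d i - 1 - u i, fun i => rfl⟩
    have hzdeg : z.degree = k := by
      have h1 : ∑ i, (u i + z i + 1) = ∑ i, d i :=
        Finset.sum_congr rfl fun i _ => by have := hlt i; have := hz i; omega
      simp only [Finset.sum_add_distrib, Finset.sum_const, Finset.card_univ, Fintype.card_fin,
        smul_eq_mul, mul_one] at h1
      rw [Finsupp.degree_eq_sum] at hdeg ⊢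
      omega
    have h2 := coeff_mem_of_mem_pow_mul_span hg (v := u + z)
      (mem_pow_mul_span hg n (hkill z hzdeg) (Ideal.mul_mem_right _ _ hβn))
      (fun i => by have := hlt i; have := hz i; simp; omega)
    simpa using h2
  · push Not at hlt
    obtain ⟨i, hi⟩ := hlt
    obtain ⟨u', hu'⟩ : ∃ u', u = u' + Finsupp.single i (d i) :=
      ⟨u - Finsupp.single i (d i), (tsub_add_cancel_of_le (by simpa using hi)).symm⟩
    have e : monomial u (coeff u β) = monomial u' (coeff u β) * g i -
        monomial u' (coeff u β) * (g i - X i ^ d i) := by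
      have : monomial u (coeff u β) = monomial u' (coeff u β) * X i ^ d i := by
        rw [X_pow_eq_monomial, monomial_mul, mul_one, ← hu']
      rw [this]
      ring
    rw [e]
    refine sub_mem (Ideal.mem_sup_left (Ideal.mul_mem_left _ _ (Ideal.subset_span ⟨i, rfl⟩)))
      (Ideal.mem_sup_right ?_)
    rw [pow_succ]
    exact Ideal.mul_mem_mul (monomial_mem_map_C_pow (mem_map_C_pow_iff.1 hβn u) _) (hg i)

theorem homogeneousComponent_mul_of_isHomogeneous {j : ℕ} (s : MvPolynomial (Fin m) R)
    {α : MvPolynomial (Fin m) R} (hα : α.IsHomogeneous j) :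
    homogeneousComponent j (s * α) = C (coeff 0 s) * α := by
  classical
  ext v
  rw [coeff_homogeneousComponent, coeff_C_mul]
  split_ifs with hv
  · rw [coeff_mul, Finset.sum_eq_single (0, v)]
    · rintro ⟨a, b⟩ hab hne
      rw [Finset.HasAntidiagonal.mem_antidiagonal] at hab
      by_cases hb : b.degree = j
      · exfalso
        have : a.degree + b.degree = v.degree := by rw [← hab, map_add]
        have ha : a = 0 := by
          rw [← Finsupp.degree_eq_zero_iff]
          omega
        subst ha
        simp at hab
        simp [hab] at hne
      · simp [hα.coeff_eq_zero hb]
    · simp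
  · rw [hα.coeff_eq_zero hv, mul_zero]

attribute [local instance] MvPolynomial.gradedAlgebra in
theorem homogeneousComponent_mem_span (hgd : ∀ i, (g i).IsHomogeneous (d i)) (j : ℕ)
    {F : MvPolynomial (Fin m) R} (hF : F ∈ Ideal.span (Set.range g)) :
    homogeneousComponent j F ∈ Ideal.span (Set.range g) := by
  refine homogeneousComponent_mem_of_mem
    (Ideal.homogeneous_span (homogeneousSubmodule (Fin m) R) _ ?_) hF j
  rintro _ ⟨i, rfl⟩
  exact ⟨d i, hgd i⟩

theorem mem_span_sup_pow (hg : ∀ i, g i - X i ^ d i ∈ 𝔟.map C)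
    (hgd : ∀ i, (g i).IsHomogeneous (d i)) {j k : ℕ}
    (hjk : j + k + m = ∑ i, d i) {α : MvPolynomial (Fin m) R} (hα : α.IsHomogeneous j)
    (hkill : ∀ z : Fin m →₀ ℕ, z.degree = k → α * monomial z 1 ∈ Ideal.span (Set.range g))
    (n : ℕ) : α ∈ Ideal.span (Set.range g) ⊔ (𝔟.map C) ^ n := by
  classical
  induction n with
  | zero => simp
  | succ n ih =>
    obtain ⟨F, hF, β, hβ, hsum⟩ := Submodule.mem_sup.1 ih
    have hF' := homogeneousComponent_mem_span hgd j hF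
    have hα' : α = homogeneousComponent j F + homogeneousComponent j β := by
      rw [← map_add, hsum, homogeneousComponent_eq_self hα]
    rw [hα']
    refine add_mem (Ideal.mem_sup_left hF') (mem_span_sup_pow_succ hg hjk
      (homogeneousComponent_isHomogeneous j β) ?_ fun z hz => ?_)
    · rw [mem_map_C_pow_iff] at hβ ⊢
      intro u
      rw [coeff_homogeneousComponent]
      split_ifs
      · exact hβ u
      · exact zero_mem _
    · rw [eq_sub_of_add_eq' hα'.symm, sub_mul]
      exact sub_mem (hkill z hz) (Ideal.mul_mem_right _ _ hF')

/-- The socle of a complete intersection that specializes to `(x_1 ^ d_1, …, x_m ^ d_m)` modulo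
`𝔟` lies in top degree, after inverting `1 + 𝔟`: a form which is killed by all monomials of
complementary degree vanishes. By `mem_span_sup_pow` it is in `J + 𝔟 ^ n` for all `n`, and
Krull's intersection theorem applies. -/
theorem exists_C_mul_mem_span [IsNoetherianRing R] (hg : ∀ i, g i - X i ^ d i ∈ 𝔟.map C)
    (hgd : ∀ i, (g i).IsHomogeneous (d i)) {j k : ℕ}
    (hjk : j + k + m = ∑ i, d i) {α : MvPolynomial (Fin m) R} (hα : α.IsHomogeneous j)
    (hkill : ∀ z : Fin m →₀ ℕ, z.degree = k → α * monomial z 1 ∈ Ideal.span (Set.range g)) :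
    ∃ r ∈ 𝔟, C (1 - r) * α ∈ Ideal.span (Set.range g) := by
  set J := Ideal.span (Set.range g) with hJ
  have hmem : Ideal.Quotient.mk J α ∈
      (⨅ n : ℕ, (𝔟.map (C (σ := Fin m))) ^ n • ⊤ :
        Submodule (MvPolynomial (Fin m) R) (MvPolynomial (Fin m) R ⧸ J)) := by
    rw [Submodule.mem_iInf]
    intro n
    obtain ⟨F, hF, β, hβ, hsum⟩ :=
      Submodule.mem_sup.1 (mem_span_sup_pow hg hgd hjk hα hkill n)
    have : Ideal.Quotient.mk J α = β • (1 : MvPolynomial (Fin m) R ⧸ J) := by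
      rw [← hsum, map_add, Ideal.Quotient.eq_zero_iff_mem.2 hF, zero_add]
      exact congrArg (Ideal.Quotient.mk J) (mul_one β).symm
    rw [this]
    exact Submodule.smul_mem_smul hβ trivial
  obtain ⟨⟨r, hr⟩, hrα⟩ := (Ideal.mem_iInf_smul_pow_eq_bot_iff _ _).1 hmem
  refine ⟨coeff 0 r, mem_map_C_iff.1 hr 0, ?_⟩
  have h1 : (1 - r) * α ∈ J := by
    rw [← Ideal.Quotient.eq_zero_iff_mem, sub_mul, one_mul, map_sub, sub_eq_zero]
    conv_lhs => rw [← hrα]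
    rfl
  have h2 := homogeneousComponent_mem_span hgd j h1
  rw [homogeneousComponent_mul_of_isHomogeneous _ hα] at h2
  simpa using h2

end Socle

/-! ### Coefficientwise derivations and the Cartier operator -/

section Coeffwise

variable {k R σ : Type*} [CommRing R] [CommRing k] [Algebra k R]

/-- The derivation of `R[x]` that applies the derivation `D` of `R` to all coefficients. -/
noncomputable def coeffDerivation (σ : Type*) (D : Derivation k R R) :
    Derivation k (MvPolynomial σ R) (MvPolynomial σ R) :=
  Derivation.mk'
    { toFun := AddMonoidAlgebra.map (D : R →+ R)
      map_add' := fun F G => by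
        ext u
        exact D.map_add _ _
      map_smul' := fun c F => by
        ext u
        exact D.map_smul c _ } fun F G => by
    classical
    ext u
    change D (coeff u (F * G)) = coeff u (F * AddMonoidAlgebra.map (D : R →+ R) G +
      G * AddMonoidAlgebra.map (D : R →+ R) F)
    rw [mul_comm G, coeff_add, coeff_mul, coeff_mul, coeff_mul, map_sum, ← Finset.sum_add_distrib]
    refine Finset.sum_congr rfl fun x _ => ?_
    rw [Derivation.leibniz, smul_eq_mul, smul_eq_mul, mul_comm (coeff x.2 G)]
    rfl

theorem coeff_coeffDerivation (D : Derivation k R R) (u : σ →₀ ℕ) (F : MvPolynomial σ R) :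
    coeff u (coeffDerivation σ D F) = D (coeff u F) :=
  rfl

theorem coeffDerivation_monomial (D : Derivation k R R) (u : σ →₀ ℕ) (c : R) :
    coeffDerivation σ D (monomial u c) = monomial u (D c) := by
  classical
  ext v
  rw [coeff_coeffDerivation, coeff_monomial, coeff_monomial]
  split_ifs
  · rfl
  · exact D.map_zero

/-- The map `R[x] → R[x]` which keeps the monomials `x ^ (p z + e)`, turns each into `x ^ z`, and
applies `ψ` to the coefficients. -/
noncomputable def cartier (p : ℕ) [Fact p.Prime] (ψ : R →+ R) (e : σ →₀ ℕ) :
    MvPolynomial σ R →+ MvPolynomial σ R where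
  toFun F := .ofCoeff ((Finsupp.comapDomain (fun z => p • z + e)
    (AddMonoidAlgebra.coeff F)
    (fun a _ b _ h => by
      ext t
      have := DFunLike.congr_fun h t
      simpa [(Fact.out : p.Prime).ne_zero] using this)).mapRange ψ ψ.map_zero)
  map_zero' := by
    ext u
    exact ψ.map_zero
  map_add' F G := by
    ext u
    exact ψ.map_add _ _

theorem coeff_cartier (p : ℕ) [Fact p.Prime] (ψ : R →+ R) (e z : σ →₀ ℕ) (F : MvPolynomial σ R) :
    coeff z (cartier p ψ e F) = ψ (coeff (p • z + e) F) :=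
  rfl

/-- `cartier` is `p⁻¹`-linear as soon as `ψ` is. -/
theorem cartier_pow_mul {p : ℕ} [Fact p.Prime] [CharP R p] {ψ : R →+ R}
    (hψ : ∀ c a, ψ (c ^ p * a) = c * ψ a) {e : σ →₀ ℕ} (he : ∀ t, e t < p)
    (F G : MvPolynomial σ R) : cartier p ψ e (F ^ p * G) = F * cartier p ψ e G := by
  classical
  have hp := (Fact.out : p.Prime).pos
  induction F using MvPolynomial.induction_on' with
  | add F₁ F₂ h₁ h₂ =>
    rw [add_pow_char, add_mul, map_add, h₁, h₂, add_mul]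
  | monomial u a =>
    ext z
    rw [coeff_cartier, monomial_pow, coeff_monomial_mul', coeff_monomial_mul']
    have hiff : p • u ≤ p • z + e ↔ u ≤ z := by
      constructor
      · intro h t
        have h1 : p * u t ≤ p * z t + e t := by simpa using h t
        have h2 := he t
        by_contra hlt
        have := Nat.mul_le_mul_left p (Nat.succ_le_of_lt (not_le.1 hlt))
        rw [Nat.mul_succ] at this
        omega
      · intro h
        exact (nsmul_le_nsmul_right h p).trans le_self_add
    by_cases huz : u ≤ z
    · rw [if_pos huz, if_pos (hiff.2 huz), hψ, coeff_cartier]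
      congr 3
      obtain ⟨w, rfl⟩ := exists_add_of_le huz
      rw [add_tsub_cancel_left, smul_add, add_assoc, add_tsub_cancel_left]
    · rw [if_neg huz, if_neg (mt hiff.1 huz), map_zero]

theorem cartier_mem_span {p : ℕ} [Fact p.Prime] [CharP R p] {ψ : R →+ R}
    (hψ : ∀ c a, ψ (c ^ p * a) = c * ψ a) {e : σ →₀ ℕ} (he : ∀ t, e t < p)
    {ι : Type*} [Fintype ι] {g : ι → MvPolynomial σ R} {F : MvPolynomial σ R}
    (hF : F ∈ Ideal.span (Set.range fun i => g i ^ p)) :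
    cartier p ψ e F ∈ Ideal.span (Set.range g) := by
  obtain ⟨c, rfl⟩ := (Ideal.mem_span_range_iff_exists_fun).1 hF
  rw [map_sum]
  refine sum_mem fun i _ => ?_
  rw [mul_comm, cartier_pow_mul hψ he]
  exact Ideal.mul_mem_right _ _ (Ideal.subset_span ⟨i, rfl⟩)

/-- A field homomorphism `f` has an additive retraction which is linear over `f`. -/
theorem exists_addMonoidHom_retraction {k L : Type*} [Field k] [Field L] (f : k →+* L) :
    ∃ ψ : L →+ k, (∀ c a, ψ (f c * a) = c * ψ a) ∧ ψ 1 = 1 := by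
  let _ := f.toAlgebra
  obtain ⟨ψ, hψ⟩ := LinearMap.exists_leftInverse_of_injective (Algebra.linearMap k L)
    (LinearMap.ker_eq_bot.2 f.injective)
  refine ⟨ψ.toAddMonoidHom, fun c a => ?_, ?_⟩
  · exact ψ.map_smul c a
  · simpa using LinearMap.congr_fun hψ 1

theorem exists_frobenius_inverse_linear (k I : Type*) [Field k] (p : ℕ) [Fact p.Prime]
    [CharP k p] : ∃ ψ : MvPolynomial I k →+ MvPolynomial I k,
      (∀ c a, ψ (c ^ p * a) = c * ψ a) ∧ ψ 1 = 1 := by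
  classical
  obtain ⟨ψ, h1, h2⟩ := exists_addMonoidHom_retraction (frobenius k p)
  refine ⟨cartier p ψ 0, cartier_pow_mul h1 fun _ => (Fact.out : p.Prime).pos, ?_⟩
  ext z
  rw [coeff_cartier, coeff_one, coeff_one]
  by_cases hz : z = 0
  · simp [hz, h2]
  · have : p • z ≠ 0 := by
      rw [Ne, smul_eq_zero, not_or]
      exact ⟨(Fact.out : p.Prime).ne_zero, hz⟩
    simp [Ne.symm hz, Ne.symm this]

theorem coeff_single_sum_X_pow {m : ℕ} (t : Fin m) (k : ℕ) :
    coeff (Finsupp.single t k) ((∑ t, X t : MvPolynomial (Fin m) R) ^ k) = 1 := by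
  classical
  induction k with
  | zero => simp
  | succ k ih =>
    rw [pow_succ, Finset.mul_sum, coeff_sum, Finset.sum_eq_single t]
    · rw [coeff_mul_X', if_pos (by simp)]
      convert ih using 2
      ext s
      by_cases hs : s = t <;> simp [hs]
    · intro s _ hs
      rw [coeff_mul_X', if_neg (by simp [hs])]
    · simp

/-- For `k < p`, multiplying `(x_1 + ⋯ + x_m) ^ k` by a suitable monomial leaves `x_t ^ k` as the
only term that `cartier` keeps: exponents of the other terms of `(x_1 + ⋯ + x_m) ^ k` differ
from that of `x_t ^ k` by less than `p`. -/
theorem cartier_sum_X_pow_mul {m p k : ℕ} [Fact p.Prime] {ψ : R →+ R} (hψ : ψ 1 = 1)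
    {e : Fin m →₀ ℕ} (he : ∀ t, e t = p - 1) (hk : k < p) (t : Fin m) (z : Fin m →₀ ℕ) :
    cartier p ψ e ((∑ t, X t) ^ k * monomial (p • z + (e - Finsupp.single t k)) 1) =
      monomial z 1 := by
  classical
  ext z'
  rw [coeff_cartier, coeff_monomial, coeff_mul_monomial', mul_one]
  have hke : Finsupp.single t k ≤ e := by
    rw [Finsupp.single_le_iff, he]
    omega
  by_cases hz : z = z'
  · subst hz
    have hsub : p • z + e - (p • z + (e - Finsupp.single t k)) = Finsupp.single t k := by
      rw [add_tsub_add_eq_tsub_left, tsub_tsub_cancel_of_le hke]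
    rw [if_pos rfl, if_pos (add_le_add_right tsub_le_self _), hsub, coeff_single_sum_X_pow, hψ]
  · rw [if_neg hz]
    split_ifs with hle
    · convert ψ.map_zero
      set u := p • z' + e - (p • z + (e - Finsupp.single t k)) with hu
      have hhom : ((∑ t, X t : MvPolynomial (Fin m) R) ^ k).IsHomogeneous k := by
        simpa using (IsHomogeneous.sum Finset.univ _ 1 fun t _ => isHomogeneous_X R t).pow k
      by_contra hne
      have hdeg : u.degree = k := by
        by_contra h
        exact hne (hhom.coeff_eq_zero h)
      refine hz (Finsupp.ext fun s => ?_)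
      have h1 : u s ≤ k := hdeg ▸ Finsupp.le_degree s u
      have h2 : u s + (p * z s + (e s - Finsupp.single t k s)) = p * z' s + e s :=
        DFunLike.congr_fun (tsub_add_cancel_of_le hle) s
      have h3 := hke s
      have h4 : Finsupp.single t k s = 0 ∨ Finsupp.single t k s = k := by
        by_cases hs : s = t <;> simp [hs]
      have h5 := he s
      rcases lt_trichotomy (z s) (z' s) with hlt | heq | hgt
      · have := Nat.mul_le_mul_left p (Nat.succ_le_of_lt hlt)
        rw [Nat.mul_succ] at this
        omega
      · exact heq
      · have := Nat.mul_le_mul_left p (Nat.succ_le_of_lt hgt)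
        rw [Nat.mul_succ] at this
        omega
    · exact ψ.map_zero

end Coeffwise

/-! ### Generic forms over the polynomial ring in the auxiliary indeterminates -/

section Polynomial

variable (𝕜 : Type*) [Field 𝕜] {m : ℕ} (d : Fin m → ℕ)

/-- The generic form `g_i`, with coefficients in the polynomial ring `𝕜[a_{i,r}]` instead of
its fraction field. -/
noncomputable def integralForm (i : Fin m) :
    MvPolynomial (Fin m) (MvPolynomial (IndexSet d) 𝕜) :=
  ∑ r : {r : Fin m →₀ ℕ // r ∈ expVectors m (d i)}, monomial r.1 (X ⟨i, r⟩)

/-- Differentiation of the coefficients with respect to `a_j`. -/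
noncomputable def auxDerivation (j : IndexSet d) :
    Derivation 𝕜 (MvPolynomial (Fin m) (MvPolynomial (IndexSet d) 𝕜))
      (MvPolynomial (Fin m) (MvPolynomial (IndexSet d) 𝕜)) :=
  coeffDerivation (Fin m) (pderiv j)

variable {𝕜 d}

theorem map_integralForm (i : Fin m) :
    map (algebraMap (MvPolynomial (IndexSet d) 𝕜) (AuxField 𝕜 d)) (integralForm 𝕜 d i) =
      genericForm 𝕜 d i := by
  simp [integralForm, genericForm, auxVar, map_monomial]

theorem degree_of_mem_expVectors {n : ℕ} {r : Fin m →₀ ℕ} :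
    r ∈ expVectors m n ↔ r.degree = n := by
  rw [mem_expVectors, Finsupp.degree_eq_sum]

theorem isHomogeneous_integralForm (i : Fin m) : (integralForm 𝕜 d i).IsHomogeneous (d i) :=
  IsHomogeneous.sum _ _ _ fun r _ => isHomogeneous_monomial _ (degree_of_mem_expVectors.1 r.2)

/-- The point of the parameter space at which every `g_i` becomes `x_i ^ d_i`. -/
noncomputable def monomialPoint (𝕜 : Type*) [Field 𝕜] {m : ℕ} (d : Fin m → ℕ) :
    IndexSet d → 𝕜 := by
  classical
  exact fun j => if j.2.1 = Finsupp.single j.1 (d j.1) then 1 else 0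

theorem integralForm_sub_mem (i : Fin m) :
    integralForm 𝕜 d i - X i ^ d i ∈ (RingHom.ker (eval (monomialPoint 𝕜 d))).map C := by
  classical
  rw [mem_map_C_iff]
  intro u
  rw [RingHom.mem_ker, coeff_sub, map_sub, sub_eq_zero, integralForm, coeff_sum, map_sum,
    X_pow_eq_monomial, coeff_monomial]
  simp only [coeff_monomial, apply_ite (eval (monomialPoint 𝕜 d)), eval_X, map_zero, map_one,
    monomialPoint]
  by_cases hu : Finsupp.single i (d i) = u
  · subst hu
    rw [if_pos rfl, Finset.sum_eq_single
      ⟨Finsupp.single i (d i), degree_of_mem_expVectors.2 (by simp)⟩]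
    · simp
    · intro r _ hr
      rw [if_neg fun h => hr (Subtype.ext h)]
    · simp
  · rw [if_neg hu]
    refine Finset.sum_eq_zero fun r _ => ?_
    split_ifs with h1 h2
    · exact absurd (h2.symm.trans h1) hu
    · rfl
    · rfl

theorem auxDerivation_monomial (j : IndexSet d) (u : Fin m →₀ ℕ)
    (c : MvPolynomial (IndexSet d) 𝕜) :
    auxDerivation 𝕜 d j (monomial u c) = monomial u (pderiv j c) :=
  coeffDerivation_monomial _ _ _

theorem auxDerivation_integralForm_self (i : Fin m)
    (r : {r : Fin m →₀ ℕ // r ∈ expVectors m (d i)}) :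
    auxDerivation 𝕜 d ⟨i, r⟩ (integralForm 𝕜 d i) = monomial r.1 1 := by
  classical
  rw [integralForm, map_sum, Finset.sum_eq_single r]
  · rw [auxDerivation_monomial, pderiv_X_self]
  · intro s _ hs
    rw [auxDerivation_monomial, pderiv_X_of_ne, monomial_zero]
    simpa using hs
  · simp

theorem auxDerivation_integralForm_of_ne {i k : Fin m} (h : k ≠ i)
    (r : {r : Fin m →₀ ℕ // r ∈ expVectors m (d i)}) :
    auxDerivation 𝕜 d ⟨i, r⟩ (integralForm 𝕜 d k) = 0 := by
  rw [integralForm, map_sum]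
  refine Finset.sum_eq_zero fun s _ => ?_
  rw [auxDerivation_monomial, pderiv_X_of_ne, monomial_zero]
  intro h'
  exact h (congrArg Sigma.fst h')

theorem derivation_prod_eq_zero {R A ι : Type*} [CommRing R] [CommRing A] [Algebra R A]
    (D : Derivation R A A) (s : Finset ι)
    (f : ι → A) (hf : ∀ i ∈ s, D (f i) = 0) : D (∏ i ∈ s, f i) = 0 := by
  classical
  induction s using Finset.induction_on with
  | empty => simp
  | insert a s ha ih =>
    rw [Finset.prod_insert ha, D.leibniz, ih fun i hi => hf i (by simp [hi]), hf a (by simp)]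
    simp

theorem derivation_pow_char {p : ℕ} {R A : Type*} [CommRing R] [CommRing A] [Algebra R A]
    [CharP A p] (D : Derivation R A A) (a : A) :
    D (a ^ p) = 0 := by
  rw [D.leibniz_pow, nsmul_eq_mul, CharP.cast_eq_zero, zero_mul]

theorem derivation_mem_span_pow {p : ℕ} {R A ι : Type*} [CommRing R] [CommRing A] [Algebra R A]
    [CharP A p] (D : Derivation R A A)
    {g : ι → A} {F : A} (hF : F ∈ Ideal.span (Set.range fun i => g i ^ p)) :
    D F ∈ Ideal.span (Set.range fun i => g i ^ p) := by
  induction hF using Submodule.span_induction with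
  | mem x hx =>
    obtain ⟨i, rfl⟩ := hx
    simp only [derivation_pow_char (p := p), zero_mem]
  | zero => simp
  | add x y _ _ hx hy => simpa using add_mem hx hy
  | smul a x hx' hx =>
    rw [smul_eq_mul, D.leibniz, smul_eq_mul, smul_eq_mul]
    exact add_mem (Ideal.mul_mem_left _ _ hx) (Ideal.mul_mem_right _ _ hx')

variable {p : ℕ} [CharP 𝕜 p]

/-- Differentiating with respect to `a_{i,r}` trades a factor `g_i` for `x ^ r`. -/
theorem mul_monomial_mul_prod_mem {β : MvPolynomial (Fin m) (MvPolynomial (IndexSet d) 𝕜)}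
    (hβ : ∀ j, auxDerivation 𝕜 d j β = 0) {e : Fin m → ℕ} {i : Fin m} (hi : 0 < e i)
    (hip : e i < p) {r : Fin m →₀ ℕ} (hr : r.degree = d i)
    (hmem : β * ∏ k, integralForm 𝕜 d k ^ e k ∈
      Ideal.span (Set.range fun k => integralForm 𝕜 d k ^ p)) :
    β * monomial r 1 * ∏ k, integralForm 𝕜 d k ^ (Function.update e i (e i - 1)) k ∈
      Ideal.span (Set.range fun k => integralForm 𝕜 d k ^ p) := by
  classical
  set P := ∏ k ∈ Finset.univ.erase i, integralForm 𝕜 d k ^ e k with hP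
  have h1 : ∏ k, integralForm 𝕜 d k ^ e k = integralForm 𝕜 d i ^ e i * P :=
    (Finset.mul_prod_erase _ _ (Finset.mem_univ i)).symm
  have h2 : ∏ k, integralForm 𝕜 d k ^ (Function.update e i (e i - 1)) k =
      integralForm 𝕜 d i ^ (e i - 1) * P := by
    rw [← Finset.mul_prod_erase _ _ (Finset.mem_univ i), Function.update_self, hP]
    congr 1
    refine Finset.prod_congr rfl fun k hk => ?_
    rw [Function.update_of_ne (Finset.ne_of_mem_erase hk)]
  set D := auxDerivation 𝕜 d ⟨i, ⟨r, degree_of_mem_expVectors.2 hr⟩⟩ with hD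
  have hDP : D P = 0 := derivation_prod_eq_zero _ _ _ fun k hk => by
    rw [D.leibniz_pow, hD, auxDerivation_integralForm_of_ne (Finset.ne_of_mem_erase hk)]
    simp
  have h3 : D (β * ∏ k, integralForm 𝕜 d k ^ e k) =
      (e i : MvPolynomial (Fin m) (MvPolynomial (IndexSet d) 𝕜)) *
        (β * monomial r 1 * (integralForm 𝕜 d i ^ (e i - 1) * P)) := by
    rw [h1, D.leibniz, D.leibniz, hDP, hβ, D.leibniz_pow, hD, auxDerivation_integralForm_self]
    simp only [smul_eq_mul, nsmul_eq_mul]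
    ring
  have h4 := derivation_mem_span_pow D hmem
  rw [h3] at h4
  have hne : (e i : 𝕜) ≠ 0 := by
    rw [Ne, CharP.cast_eq_zero_iff 𝕜 p]
    exact Nat.not_dvd_of_pos_of_lt hi hip
  have h5 := Ideal.mul_mem_left _ (C (C (e i : 𝕜)⁻¹)) h4
  rw [← mul_assoc, ← map_natCast (C (σ := Fin m) (R := MvPolynomial (IndexSet d) 𝕜)),
    ← map_natCast (C (σ := IndexSet d) (R := 𝕜)), ← C_mul, ← C_mul, inv_mul_cancel₀ hne, C_1,
    C_1, one_mul] at h5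
  rwa [h2]

/-- The forms `g_i`, each with its own multiplicity `e_i < p`, can be traded for any monomial of
at least the same degree. -/
theorem mul_monomial_mem_of_mul_prod_mem (N : ℕ) :
    ∀ {β : MvPolynomial (Fin m) (MvPolynomial (IndexSet d) 𝕜)} {e : Fin m → ℕ}
    {T : Fin m →₀ ℕ}, ∑ i, e i = N → (∀ j, auxDerivation 𝕜 d j β = 0) → (∀ i, e i < p) →
    ∑ i, e i * d i ≤ T.degree →
    β * ∏ k, integralForm 𝕜 d k ^ e k ∈ Ideal.span (Set.range fun k => integralForm 𝕜 d k ^ p) →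
    β * monomial T 1 ∈ Ideal.span (Set.range fun k => integralForm 𝕜 d k ^ p) := by
  classical
  induction N with
  | zero =>
    intro β e T hN _ _ _ hmem
    have he : ∀ i, e i = 0 := fun i => (Finset.sum_eq_zero_iff.1 hN) i (Finset.mem_univ i)
    simp only [he, pow_zero, Finset.prod_const_one, mul_one] at hmem
    exact Ideal.mul_mem_right _ _ hmem
  | succ N ih =>
    intro β e T hN hβ hep hT hmem
    obtain ⟨i, -, hi⟩ : ∃ i ∈ Finset.univ, e i ≠ 0 :=
      Finset.exists_ne_zero_of_sum_ne_zero (by omega)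
    have hupd : ∀ f : Fin m → ℕ, ∑ k, Function.update e i (e i - 1) k * f k + f i =
        ∑ k, e k * f k := by
      intro f
      rw [← Finset.add_sum_erase _ _ (Finset.mem_univ i),
        ← Finset.add_sum_erase _ (fun k => e k * f k) (Finset.mem_univ i), Function.update_self]
      have : ∑ k ∈ Finset.univ.erase i, Function.update e i (e i - 1) k * f k =
          ∑ k ∈ Finset.univ.erase i, e k * f k :=
        Finset.sum_congr rfl fun k hk => by
          rw [Function.update_of_ne (Finset.ne_of_mem_erase hk)]
      rw [this]
      obtain ⟨n, hn⟩ := Nat.exists_eq_succ_of_ne_zero hi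
      rw [hn, Nat.succ_sub_one, Nat.succ_mul]
      ring
    have hud := hupd d
    have hu1 := hupd fun _ => 1
    simp only [mul_one] at hu1
    obtain ⟨r, hrT, hr⟩ := Finsupp.exists_le_degree_eq T (d i) (by omega)
    have hsplit : monomial T (1 : MvPolynomial (IndexSet d) 𝕜) =
        monomial r 1 * monomial (T - r) 1 := by
      rw [monomial_mul, mul_one, add_tsub_cancel_of_le hrT]
    have hdeg : T.degree = r.degree + (T - r).degree := by
      rw [← map_add, add_tsub_cancel_of_le hrT]
    rw [hsplit, ← mul_assoc]
    refine ih (e := Function.update e i (e i - 1)) (by omega) (fun j => ?_) (fun k => ?_)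
      (by omega) (mul_monomial_mul_prod_mem hβ (Nat.pos_of_ne_zero hi) (hep i) hr hmem)
    · rw [Derivation.leibniz, hβ, auxDerivation_monomial, pderiv_one]
      simp
    · by_cases hk : k = i
      · subst hk
        have := hep k
        simp
        omega
      · rw [Function.update_of_ne hk]
        exact hep k

variable [Fact p.Prime]

/-- If `α ^ p ℓ ^ k` lies in `J = (g_1, …, g_m)`, then `α ^ p ℓ ^ k ∏ g_j ^ (p - 1)` lies in
`(g_1 ^ p, …, g_m ^ p)`. The factors `g_j` are traded for a monomial, chosen so that `cartier`
sends the result to `α x ^ z`. -/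
theorem mul_monomial_mem_of_pow_mul_mem {i k s : ℕ} (hs : s + m = ∑ i, d i) (hk : k < p)
    (hiks : p * i + k ≤ s) (t : Fin m) {α : MvPolynomial (Fin m) (MvPolynomial (IndexSet d) 𝕜)}
    (hmem : α ^ p * (∑ t, X t) ^ k ∈ Ideal.span (Set.range (integralForm 𝕜 d)))
    {z : Fin m →₀ ℕ} (hz : z.degree + i = s) :
    α * monomial z 1 ∈ Ideal.span (Set.range (integralForm 𝕜 d)) := by
  classical
  have hp := (Fact.out : p.Prime).pos
  have h1 : α ^ p * (∑ t, X t) ^ k * ∏ j, integralForm 𝕜 d j ^ (p - 1) ∈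
      Ideal.span (Set.range fun j => integralForm 𝕜 d j ^ p) := by
    obtain ⟨c, hc⟩ := Ideal.mem_span_range_iff_exists_fun.1 hmem
    rw [← hc, Finset.sum_mul]
    refine sum_mem fun j _ => ?_
    rw [← Finset.mul_prod_erase _ _ (Finset.mem_univ j)]
    have : c j * integralForm 𝕜 d j * (integralForm 𝕜 d j ^ (p - 1) *
        ∏ x ∈ Finset.univ.erase j, integralForm 𝕜 d x ^ (p - 1)) =
        (c j * ∏ x ∈ Finset.univ.erase j, integralForm 𝕜 d x ^ (p - 1)) *
          integralForm 𝕜 d j ^ p := by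
      obtain ⟨q, rfl⟩ := Nat.exists_eq_succ_of_ne_zero hp.ne'
      rw [Nat.succ_sub_one, pow_succ]
      ring
    rw [this]
    exact Ideal.mul_mem_left _ _ (Ideal.subset_span ⟨j, rfl⟩)
  obtain ⟨e, he⟩ : ∃ e : Fin m →₀ ℕ, ∀ t, e t = p - 1 :=
    ⟨Finsupp.equivFunOnFinite.symm fun _ => p - 1, fun _ => rfl⟩
  have hke : Finsupp.single t k ≤ e := by
    rw [Finsupp.single_le_iff, he]
    omega
  set T := p • z + (e - Finsupp.single t k) with hT
  have hTdeg : ∑ i, (p - 1) * d i ≤ T.degree := by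
    have h2 : (e - Finsupp.single t k).degree + k = m * (p - 1) := by
      have := congrArg Finsupp.degree (tsub_add_cancel_of_le hke)
      rw [map_add, Finsupp.degree_single] at this
      rw [this, Finsupp.degree_eq_sum]
      simp [he]
    have h3 : T.degree = p * z.degree + (e - Finsupp.single t k).degree := by
      rw [hT, map_add, map_nsmul, smul_eq_mul]
    -- Both sides compare as `(p - 1) s + (p - 1) m ≤ p (s - i) + (p - 1) m - k`.
    rw [← Finset.mul_sum, ← hs, h3]
    obtain ⟨q, rfl⟩ := Nat.exists_eq_succ_of_ne_zero hp.ne'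
    rw [Nat.succ_sub_one] at h2 ⊢
    rw [← hz] at hiks ⊢
    rw [Nat.succ_eq_add_one] at *
    nlinarith
  have hD : ∀ j, auxDerivation 𝕜 d j (α ^ p * (∑ t, X t) ^ k) = 0 := by
    intro j
    have hX : auxDerivation 𝕜 d j (∑ t, X t) = 0 := by
      rw [map_sum]
      refine Finset.sum_eq_zero fun t _ => ?_
      rw [X, auxDerivation_monomial, pderiv_one, monomial_zero]
    rw [Derivation.leibniz, derivation_pow_char (p := p), Derivation.leibniz_pow, hX]
    simp
  have h4 := mul_monomial_mem_of_mul_prod_mem _ rfl hD (fun _ => by omega) hTdeg h1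
  obtain ⟨ψ, hψ, hψ1⟩ := exists_frobenius_inverse_linear 𝕜 (IndexSet d) p
  have h5 := cartier_mem_span hψ (e := e) (fun t => by rw [he]; omega) h4
  rwa [mul_assoc, cartier_pow_mul hψ (fun t => by rw [he]; omega),
    cartier_sum_X_pow_mul hψ1 he hk] at h5

/-- The claim for `k < p` over the polynomial ring `𝕜[a_{i,r}]`, up to torsion. -/
theorem exists_mul_mem_of_pow_mul_mem {i k s : ℕ} (hs : s + m = ∑ i, d i) (hk : k < p)
    (hiks : p * i + k ≤ s) (t : Fin m) {α : MvPolynomial (Fin m) (MvPolynomial (IndexSet d) 𝕜)}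
    (hα : α.IsHomogeneous i)
    (hmem : α ^ p * (∑ t, X t) ^ k ∈ Ideal.span (Set.range (integralForm 𝕜 d))) :
    ∃ c : MvPolynomial (IndexSet d) 𝕜, c ≠ 0 ∧
      C c * α ∈ Ideal.span (Set.range (integralForm 𝕜 d)) := by
  have his : i ≤ s := by
    have := Nat.le_mul_of_pos_left i (Fact.out : p.Prime).pos
    omega
  obtain ⟨r, hr, hrα⟩ := exists_C_mul_mem_span (k := s - i) integralForm_sub_mem
    isHomogeneous_integralForm (by omega) hα
    fun z hz => mul_monomial_mem_of_pow_mul_mem hs hk hiks t hmem (by omega)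
  refine ⟨1 - r, fun h => ?_, hrα⟩
  rw [RingHom.mem_ker, ← sub_eq_zero.1 h, map_one] at hr
  exact one_ne_zero hr

end Polynomial

/-! ### Passage to the field of rational functions -/

section Field

variable {𝕜 : Type*} [Field 𝕜] {m : ℕ} {d : Fin m → ℕ}

theorem genericIdeal_eq_map : genericIdeal 𝕜 d =
    (Ideal.span (Set.range (integralForm 𝕜 d))).map
      (map (algebraMap (MvPolynomial (IndexSet d) 𝕜) (AuxField 𝕜 d))) := by
  rw [Ideal.map_span, ← Set.range_comp, genericIdeal]
  exact congrArg (fun f => Ideal.span (Set.range f)) (funext fun i => (map_integralForm i).symm)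

attribute [local instance] MvPolynomial.algebraMvPolynomial in
theorem exists_integral_multiple (α : MvPolynomial (Fin m) (AuxField 𝕜 d)) :
    ∃ c : MvPolynomial (IndexSet d) 𝕜, c ≠ 0 ∧
      ∃ α' : MvPolynomial (Fin m) (MvPolynomial (IndexSet d) 𝕜),
        map (algebraMap (MvPolynomial (IndexSet d) 𝕜) (AuxField 𝕜 d)) α' =
          C (algebraMap _ _ c) * α := by
  obtain ⟨⟨α', _, c, hc, rfl⟩, h⟩ := IsLocalization.surj
    ((nonZeroDivisors (MvPolynomial (IndexSet d) 𝕜)).map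
      (C (σ := Fin m) (R := MvPolynomial (IndexSet d) 𝕜))) α
  refine ⟨c, nonZeroDivisors.ne_zero hc, α', ?_⟩
  rw [algebraMap_def, map_C] at h
  rw [mul_comm]
  exact h.symm

attribute [local instance] MvPolynomial.algebraMvPolynomial in
theorem map_mem_genericIdeal_iff
    {F : MvPolynomial (Fin m) (MvPolynomial (IndexSet d) 𝕜)} :
    map (algebraMap (MvPolynomial (IndexSet d) 𝕜) (AuxField 𝕜 d)) F ∈ genericIdeal 𝕜 d ↔
      ∃ c : MvPolynomial (IndexSet d) 𝕜, c ≠ 0 ∧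
        C c * F ∈ Ideal.span (Set.range (integralForm 𝕜 d)) := by
  rw [genericIdeal_eq_map]
  have := IsLocalization.algebraMap_mem_map_algebraMap_iff
    ((nonZeroDivisors (MvPolynomial (IndexSet d) 𝕜)).map
      (C (σ := Fin m) (R := MvPolynomial (IndexSet d) 𝕜)))
    (MvPolynomial (Fin m) (AuxField 𝕜 d)) (Ideal.span (Set.range (integralForm 𝕜 d))) F
  refine this.trans ?_
  constructor
  · rintro ⟨_, ⟨c, hc, rfl⟩, h⟩
    exact ⟨c, nonZeroDivisors.ne_zero hc, h⟩
  · rintro ⟨c, hc, h⟩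
    exact ⟨_, ⟨c, mem_nonZeroDivisors_of_ne_zero hc, rfl⟩, h⟩

theorem C_algebraMap_mul_mem_genericIdeal_iff {c : MvPolynomial (IndexSet d) 𝕜} (hc : c ≠ 0)
    {F : MvPolynomial (Fin m) (AuxField 𝕜 d)} :
    C (algebraMap _ (AuxField 𝕜 d) c) * F ∈ genericIdeal 𝕜 d ↔ F ∈ genericIdeal 𝕜 d := by
  refine Ideal.unit_mul_mem_iff_mem _ (IsUnit.map C (IsUnit.mk0 _ ?_))
  simpa using hc

theorem proj_eq_zero_iff {F : MvPolynomial (Fin m) (AuxField 𝕜 d)} :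
    proj 𝕜 d F = 0 ↔ F ∈ genericIdeal 𝕜 d :=
  Ideal.Quotient.eq_zero_iff_mem

variable {p : ℕ} [Fact p.Prime] [CharP 𝕜 p]

theorem mem_genericIdeal_of_lt {i k s : ℕ} (hs : s + m = ∑ i, d i) (hk : k < p)
    (hiks : p * i + k ≤ s) {α : MvPolynomial (Fin m) (AuxField 𝕜 d)} (hα : α.IsHomogeneous i)
    (hmem : α ^ p * linForm 𝕜 d ^ k ∈ genericIdeal 𝕜 d) : α ∈ genericIdeal 𝕜 d := by
  -- For `m = 0` there is no variable to single out, but then `k = 0` and the ideal is zero.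
  rcases isEmpty_or_nonempty (Fin m) with hm | ⟨⟨t⟩⟩
  · have hk0 : k = 0 := by
      have : s = 0 := by
        have : ∑ i, d i = 0 := by simp
        omega
      omega
    have hbot : genericIdeal 𝕜 d = ⊥ := by
      rw [genericIdeal, Set.range_eq_empty, Ideal.span_empty]
    rw [hk0, pow_zero, mul_one, hbot, Ideal.mem_bot] at hmem
    rw [eq_zero_of_pow_eq_zero hmem]
    exact zero_mem _
  · obtain ⟨c, hc, α', hα'⟩ := exists_integral_multiple α
    have hinj := IsFractionRing.injective (MvPolynomial (IndexSet d) 𝕜) (AuxField 𝕜 d)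
    have hα'h : α'.IsHomogeneous i := by
      refine IsHomogeneous.of_map hinj ?_
      rw [hα']
      exact hα.C_mul _
    have h1 : map (algebraMap (MvPolynomial (IndexSet d) 𝕜) (AuxField 𝕜 d))
        (α' ^ p * (∑ t, X t) ^ k) ∈ genericIdeal 𝕜 d := by
      have : map (algebraMap (MvPolynomial (IndexSet d) 𝕜) (AuxField 𝕜 d))
          (α' ^ p * (∑ t, X t) ^ k) =
          C (algebraMap _ (AuxField 𝕜 d) c) ^ p * (α ^ p * linForm 𝕜 d ^ k) := by
        rw [map_mul, map_pow, hα', map_pow, map_sum, linForm]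
        simp only [map_X]
        ring
      rw [this]
      exact Ideal.mul_mem_left _ _ hmem
    obtain ⟨b, hb, h2⟩ := map_mem_genericIdeal_iff.1 h1
    have h3 : (C b * α') ^ p * (∑ t, X t) ^ k ∈ Ideal.span (Set.range (integralForm 𝕜 d)) := by
      obtain ⟨q, rfl⟩ := Nat.exists_eq_succ_of_ne_zero (Fact.out : p.Prime).ne_zero
      have : (C b * α') ^ q.succ * (∑ t, X t) ^ k =
          C b ^ q * (C b * (α' ^ q.succ * (∑ t, X t) ^ k)) := by
        rw [pow_succ, pow_succ]
        ring
      rw [this]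
      exact Ideal.mul_mem_left _ _ h2
    obtain ⟨a, ha, h4⟩ := exists_mul_mem_of_pow_mul_mem hs hk hiks t (hα'h.C_mul b) h3
    rw [← mul_assoc, ← C_mul] at h4
    have h5 := map_mem_genericIdeal_iff.2 ⟨a * b, mul_ne_zero ha hb, h4⟩
    rwa [hα', C_algebraMap_mul_mem_genericIdeal_iff hc] at h5

/-- Writing `k = p q + r` with `r < p`, one has `α ^ p ℓ ^ k = (α ℓ ^ q) ^ p ℓ ^ r`, which reduces
the claim for `k` to those for `r` and for `q`. -/
theorem mem_genericIdeal_of_pow_mul_mem {s : ℕ} (hs : s + m = ∑ i, d i) (k : ℕ) :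
    ∀ {i : ℕ} {α : MvPolynomial (Fin m) (AuxField 𝕜 d)}, p * i + k ≤ s → α.IsHomogeneous i →
    α ^ p * linForm 𝕜 d ^ k ∈ genericIdeal 𝕜 d → α ∈ genericIdeal 𝕜 d := by
  induction k using Nat.strong_induction_on with
  | _ k ih =>
  intro i α hiks hα hmem
  have hp := (Fact.out : p.Prime)
  rcases lt_or_ge k p with hk | hk
  · exact mem_genericIdeal_of_lt hs hk hiks hα hmem
  · have hdiv := Nat.div_add_mod k p
    have hqk : k / p < k := Nat.div_lt_self (hp.pos.trans_le hk) hp.one_lt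
    have hl : (linForm 𝕜 d ^ (k / p)).IsHomogeneous (k / p) := by
      simpa [linForm] using (IsHomogeneous.sum Finset.univ _ 1 fun t _ =>
        isHomogeneous_X (AuxField 𝕜 d) t).pow (k / p)
    have h1 : (α * linForm 𝕜 d ^ (k / p)) ^ p * linForm 𝕜 d ^ (k % p) ∈ genericIdeal 𝕜 d := by
      rwa [mul_pow, ← pow_mul, mul_assoc, ← pow_add, mul_comm (k / p), hdiv]
    have h2 := mem_genericIdeal_of_lt hs (Nat.mod_lt k hp.pos)
      (by rw [mul_add]; omega) (hα.mul hl) h1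
    refine ih (k / p) hqk (by omega) hα ?_
    obtain ⟨q, hq⟩ := Nat.exists_eq_succ_of_ne_zero hp.ne_zero
    rw [hq, pow_succ, mul_assoc]
    exact Ideal.mul_mem_left _ _ (hq ▸ h2)

end Field

end GenericCI

theorem proposition4p4 {𝕜 : Type*} [Field 𝕜] (p : ℕ) [Fact p.Prime] [CharP 𝕜 p]
    {m : ℕ} (d : Fin m → ℕ) (hd : ∀ i, 0 < d i) :
    (∀ (i k : ℕ) (α : MvPolynomial (Fin m) (GenericCI.AuxField 𝕜 d)),
      α.IsHomogeneous i →
      (p : ℤ) * i + k ≤ GenericCI.topDegree d →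
      GenericCI.proj 𝕜 d α ≠ 0 →
      GenericCI.proj 𝕜 d (α ^ p * GenericCI.linForm 𝕜 d ^ k) ≠ 0) ∧
    (∀ (i : ℕ) (α : GenericCI.Reduction 𝕜 d),
      α ∈ GenericCI.gradedPiece 𝕜 d i →
      (i : ℚ) ≤ (GenericCI.topDegree d : ℚ) / p →
      α ≠ 0 → α ^ p ≠ 0) := by
  obtain ⟨s, hs⟩ : ∃ s, s + m = ∑ i, d i := by
    have : m ≤ ∑ i, d i := by
      simpa using Finset.sum_le_sum fun i (_ : i ∈ Finset.univ) => Nat.succ_le_of_lt (hd i)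
    exact ⟨_, Nat.sub_add_cancel this⟩
  have htop : GenericCI.topDegree d = s := by
    rw [GenericCI.topDegree, ← Nat.cast_sum, ← hs]
    push_cast
    ring
  have key : ∀ (i k : ℕ) (α : MvPolynomial (Fin m) (GenericCI.AuxField 𝕜 d)),
      α.IsHomogeneous i → (p : ℤ) * i + k ≤ GenericCI.topDegree d → GenericCI.proj 𝕜 d α ≠ 0 →
      GenericCI.proj 𝕜 d (α ^ p * GenericCI.linForm 𝕜 d ^ k) ≠ 0 := by
    intro i k α hα hle hne h0
    rw [htop] at hle
    exact hne (GenericCI.proj_eq_zero_iff.2 (GenericCI.mem_genericIdeal_of_pow_mul_mem hs k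
      (by exact_mod_cast hle) hα (GenericCI.proj_eq_zero_iff.1 h0)))
  refine ⟨key, ?_⟩
  rintro i _ ⟨α, hα, rfl⟩ hle hne h0
  refine key i 0 α hα ?_ hne ?_
  · have hp : (0 : ℚ) < p := by exact_mod_cast (Fact.out : p.Prime).pos
    rw [le_div_iff₀ hp, mul_comm] at hle
    simpa using (by exact_mod_cast hle : (p : ℤ) * i ≤ GenericCI.topDegree d)
  · simpa using h0
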